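/- Let $M$ be a smooth manifold (Hausdorff, second countable, without boundary) and let $A\to M$ be a Lie algebroid: a smooth real vector bundle of finite rank with an anchor $\rho$, i.e. a smooth bundle map $\rho:A\to TM$ over the identity, and an $\mathbb R$-bilinear Lie bracket on the space $\Gamma(A)$ of smooth sections such that $[\alpha,f\beta]=f[\alpha,\beta]+\rho(\alpha)(f)\,\beta$ for all $\alpha,\beta\in\Gamma(A)$, $f\in C^\infty(M)$. An *IM form* on $A$ is a smooth bundle map $\sigma:A\to T^*M$ over the identity such that, for all $\alpha,\beta\in\Gamma(A)$, $$\langle\sigma(\alpha),\rho(\beta)\rangle=-\langle\sigma(\beta),\rho(\alpha)\rangle,\qquad \sigma([\alpha,\beta])=L_{\rho(\alpha)}(\sigma(\beta))-L_{\rho(\beta)}(\sigma(\alpha))+d\langle\sigma(\alpha),\rho(\beta)\rangle .$$ The relevant bidegrees of the intrinsic Weil algebra $W(A)$ are the following. * For $q=2,3$, $W^{1,q}(A)$ is the set of pairs $c=(c_0,c_1)$ with $c_0:\Gamma(A)\to\Omega^q(M)$ $\mathbb R$-linear and $c_1\in\Omega^{q-1}(M;A^*)$, i.e. $c_1:\Gamma(A)\to\Omega^{q-1}(M)$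 is $C^\infty(M)$-linear, such that $c_0(f\alpha)=f\,c_0(\alpha)-df\wedge c_1(\alpha)$. * $W^{2,2}(A)$ is the set of triples $(c_0,c_1,c_2)$ with $c_0:\Gamma(A)\times\Gamma(A)\to\Omega^2(M)$ $\mathbb R$-bilinear and antisymmetric, $c_1:\Gamma(A)\to\Omega^1(M;A^*)$ $\mathbb R$-linear and $c_2\in\Gamma(S^2A^*)$, such that $c_0(\alpha,f\beta)=f\,c_0(\alpha,\beta)-df\wedge c_1(\alpha)(\beta)$ and $c_1(f\alpha)(\beta)=f\,c_1(\alpha)(\beta)-c_2(\alpha,\beta)\,df$. The vertical differential $d^{\mathrm{ver}}:W^{1,2}(A)\to W^{1,3}(A)$ is given by $$(d^{\mathrm{ver}}c)_0(\alpha)=-d(c_0(\alpha)),\qquad (d^{\mathrm{ver}}c)_1(\alpha)=c_0(\alpha)+d(c_1(\alpha)),$$ and the horizontal differential $d^{\mathrm{hor}}:W^{1,2}(A)\to W^{2,2}(A)$ by $$\begin{aligned}(d^{\mathrm{hor}}c)_0(\alpha,\beta)&=-c_0([\alpha,\beta])+L_{\rho(\alpha)}(c_0(\beta))-L_{\rho(\beta)}(c_0(\alpha)),\\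 (d^{\mathrm{hor}}c)_1(\alpha)(\beta)&=-c_1([\alpha,\beta])+L_{\rho(\alpha)}(c_1(\beta))+i_{\rho(\beta)}(c_0(\alpha)),\\ (d^{\mathrm{hor}}c)_2(\alpha,\beta)&=-i_{\rho(\alpha)}(c_1(\beta))-i_{\rho(\beta)}(c_1(\alpha)).\end{aligned}$$ **Proposition.** The map $\sigma\mapsto c_\sigma=(-d\sigma,\sigma)$, that is $(c_\sigma)_0(\alpha)=-d(\sigma(\alpha))$ and $(c_\sigma)_1=\sigma$, is a bijection from the set of IM forms on $A$ onto the set of elements $c\in W^{1,2}(A)$ with $d^{\mathrm{hor}}c=0$ and $d^{\mathrm{ver}}c=0$. -/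

import Mathlib

open Bundle VectorField
open scoped Manifold ContDiff

namespace LieAlgd

set_option linter.unusedSectionVars false

/-! ### Cartan calculus of a Lie-Rinehart algebra

`C` plays the role of the ring of smooth functions and `X` that of the vector fields. -/

section Cartan

/-- Differential `k`-forms, as alternating `C`-multilinear maps `X × ⋯ × X → C`. -/
abbrev Form (C X : Type*) [CommRing C] [AddCommGroup X] [Module C X] (k : ℕ) :=
  X [⋀^Fin k]→ₗ[C] C

variable {C X : Type*} [CommRing C] [LieRing X] [Module C X]

/-- A `1`-form from its values. -/
def Form.mk₁ (B : X →ₗ[C] C) : Form C X 1 := AlternatingMap.ofSubsingleton C X C 0 B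

@[simp] theorem Form.mk₁_apply (B : X →ₗ[C] C) (x : X) : Form.mk₁ B ![x] = B x := rfl

/-- A `2`-form from its values. -/
def Form.mk₂ (B : X → X → C) (hadd : ∀ x x' y, B (x + x') y = B x y + B x' y)
    (hsmul : ∀ (f : C) x y, B (f • x) y = f * B x y)
    (hself : ∀ x, B x x = 0) (hswap : ∀ x y, B x y = -B y x) : Form C X 2 where
  toFun v := B (v 0) (v 1)
  map_update_add' := by
    intro _ v i x y
    fin_cases i
    · simp [hadd]
    · simp only [Fin.mk_one, Fin.isValue, Function.update_self, ne_eq, zero_ne_one,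
        not_false_eq_true, Function.update_of_ne]
      rw [hswap, hadd, hswap x, hswap y]; ring
  map_update_smul' := by
    intro _ v i f x
    fin_cases i
    · simp [hsmul]
    · simp only [Fin.mk_one, Fin.isValue, Function.update_self, ne_eq, zero_ne_one,
        not_false_eq_true, Function.update_of_ne]
      rw [hswap, hsmul, hswap x, smul_eq_mul]; ring
  map_eq_zero_of_eq' := by
    intro v i j hv hij
    fin_cases i <;> fin_cases j
    · exact absurd rfl hij
    · change B (v 0) (v 1) = 0
      rw [show v 1 = v 0 from hv.symm, hself]
    · change B (v 0) (v 1) = 0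
      rw [show v 1 = v 0 from hv, hself]
    · exact absurd rfl hij

@[simp] theorem Form.mk₂_apply (B : X → X → C) (h₁ h₂ h₃ h₄) (x y : X) :
    Form.mk₂ B h₁ h₂ h₃ h₄ ![x, y] = B x y := rfl

/-- A `3`-form from its values. -/
def Form.mk₃ (B : X → X → X → C) (hadd : ∀ x x' y z, B (x + x') y z = B x y z + B x' y z)
    (hsmul : ∀ (f : C) x y z, B (f • x) y z = f * B x y z)
    (hself : ∀ x z, B x x z = 0)
    (hswap : ∀ x y z, B x y z = -B y x z) (hswap' : ∀ x y z, B x y z = -B x z y) :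
    Form C X 3 where
  toFun v := B (v 0) (v 1) (v 2)
  map_update_add' := by
    intro _ v i x y
    have h01 : (0 : Fin 3) ≠ 1 := fun h => absurd (congrArg Fin.val h) (by norm_num)
    have h02 : (0 : Fin 3) ≠ 2 := fun h => absurd (congrArg Fin.val h) (by norm_num)
    have h12 : (1 : Fin 3) ≠ 2 := fun h => absurd (congrArg Fin.val h) (by norm_num)
    fin_cases i
    · simp [hadd, h01.symm, h02.symm]
    · simp only [Fin.mk_one, Function.update_self, Function.update_of_ne h01,
        Function.update_of_ne h12.symm]
      rw [hswap, hadd, hswap _ x, hswap _ y]; ring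
    · simp only [Fin.reduceFinMk, Function.update_self, Function.update_of_ne h02,
        Function.update_of_ne h12]
      rw [hswap', hswap, hadd, hswap' _ _ x, hswap' _ _ y, hswap _ x, hswap _ y]; ring
  map_update_smul' := by
    intro _ v i f x
    have h01 : (0 : Fin 3) ≠ 1 := fun h => absurd (congrArg Fin.val h) (by norm_num)
    have h02 : (0 : Fin 3) ≠ 2 := fun h => absurd (congrArg Fin.val h) (by norm_num)
    have h12 : (1 : Fin 3) ≠ 2 := fun h => absurd (congrArg Fin.val h) (by norm_num)
    fin_cases i
    · simp [hsmul, h01.symm, h02.symm]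
    · simp only [Fin.mk_one, Function.update_self, Function.update_of_ne h01,
        Function.update_of_ne h12.symm, smul_eq_mul]
      rw [hswap, hsmul, hswap _ x]; ring
    · simp only [Fin.reduceFinMk, Function.update_self, Function.update_of_ne h02,
        Function.update_of_ne h12, smul_eq_mul]
      rw [hswap', hswap, hsmul, hswap' _ _ x, hswap _ x]; ring
  map_eq_zero_of_eq' := by
    have h13 : ∀ x y, B x y x = 0 := fun x y => by rw [hswap', hself, neg_zero]
    have h23 : ∀ x y, B x y y = 0 := fun x y => by rw [hswap, h13, neg_zero]
    intro v i j hv hij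
    change B (v 0) (v 1) (v 2) = 0
    fin_cases i <;> fin_cases j
    · exact absurd rfl hij
    · rw [show v 1 = v 0 from hv.symm, hself]
    · rw [show v 2 = v 0 from hv.symm, h13]
    · rw [show v 1 = v 0 from hv, hself]
    · exact absurd rfl hij
    · rw [show v 2 = v 1 from hv.symm, h23]
    · rw [show v 2 = v 0 from hv, h13]
    · rw [show v 2 = v 1 from hv, h23]
    · exact absurd rfl hij

@[simp] theorem Form.mk₃_apply (B : X → X → X → C) (h₁ h₂ h₃ h₄ h₅) (x y z : X) :
    Form.mk₃ B h₁ h₂ h₃ h₄ h₅ ![x, y, z] = B x y z := rfl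

theorem Form.ext₁ {w η : Form C X 1} (h : ∀ x, w ![x] = η ![x]) : w = η := by
  ext v; convert h (v 0) using 2 <;> · ext i; fin_cases i; rfl

theorem Form.ext₂ {w η : Form C X 2} (h : ∀ x y, w ![x, y] = η ![x, y]) : w = η := by
  ext v; convert h (v 0) (v 1) using 2 <;> · ext i; fin_cases i <;> rfl

theorem Form.ext₃ {w η : Form C X 3} (h : ∀ x y z, w ![x, y, z] = η ![x, y, z]) : w = η := by
  ext v; convert h (v 0) (v 1) (v 2) using 2 <;> · ext i; fin_cases i <;> rfl

theorem Form.add₁ (w : Form C X 1) (x x' : X) : w ![x + x'] = w ![x] + w ![x'] := by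
  simpa using w.map_vecCons_add ![] x x'

theorem Form.smul₁ (w : Form C X 1) (f : C) (x : X) : w ![f • x] = f * w ![x] := by
  simpa using w.map_vecCons_smul ![] f x

theorem Form.add₂ (w : Form C X 2) (x x' y : X) :
    w ![x + x', y] = w ![x, y] + w ![x', y] := by
  simpa using w.map_vecCons_add ![y] x x'

theorem Form.smul₂ (w : Form C X 2) (f : C) (x y : X) : w ![f • x, y] = f * w ![x, y] := by
  simpa using w.map_vecCons_smul ![y] f x

theorem Form.self₂ (w : Form C X 2) (x : X) : w ![x, x] = 0 :=
  w.map_eq_zero_of_eq _ (i := 0) (j := 1) rfl (by decide)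

theorem Form.swap₂ (w : Form C X 2) (x y : X) : w ![x, y] = -w ![y, x] := by
  have := w.map_swap ![y, x] (i := 0) (j := 1) (by decide)
  rw [← this]
  congr 1
  ext i; fin_cases i <;> simp

theorem Form.add₂' (w : Form C X 2) (x y y' : X) :
    w ![x, y + y'] = w ![x, y] + w ![x, y'] := by
  rw [w.swap₂, w.add₂, w.swap₂ x y, w.swap₂ x y']; ring

theorem Form.smul₂' (w : Form C X 2) (f : C) (x y : X) : w ![x, f • y] = f * w ![x, y] := by
  rw [w.swap₂, w.smul₂, w.swap₂ x y]; ring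

/-- The interior product of a `2`-form: `(i_x w)(y) = w(x, y)`. -/
def ι (x : X) (w : Form C X 2) : Form C X 1 :=
  Form.mk₁
    { toFun := fun y => w ![x, y]
      map_add' := fun y z => w.add₂' x y z
      map_smul' := fun f y => w.smul₂' f x y }

@[simp] theorem ι_apply (x : X) (w : Form C X 2) (y : X) : ι x w ![y] = w ![x, y] := rfl

theorem ι_add (x : X) (w w' : Form C X 2) : ι x (w + w') = ι x w + ι x w' := rfl

theorem ι_sub (x : X) (w w' : Form C X 2) : ι x (w - w') = ι x w - ι x w' := rfl

theorem ι_smul (x : X) (f : C) (w : Form C X 2) : ι x (f • w) = f • ι x w := rfl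

theorem ι_add_left (x x' : X) (w : Form C X 2) : ι (x + x') w = ι x w + ι x' w := by
  apply Form.ext₁; intro y; exact w.add₂ x x' y

theorem ι_smul_left (x : X) (f : C) (w : Form C X 2) : ι (f • x) w = f • ι x w := by
  apply Form.ext₁; intro y; exact w.smul₂ f x y

variable [LieRingModule X C] [LieRinehartRing C X]

/-- The linear map `x ↦ x(f)`. -/
def dLin (f : C) : X →ₗ[C] C where
  toFun x := ⁅x, f⁆
  map_add' x y := add_lie x y f
  map_smul' g x := by simp

/-- The exterior derivative of a function. -/
def d₀ (f : C) : Form C X 1 := Form.mk₁ (dLin f)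

/-- The exterior derivative of a `1`-form:
`dw(x,y) = x(w(y)) - y(w(x)) - w([x,y])`. -/
def d₁ (w : Form C X 1) : Form C X 2 :=
  Form.mk₂ (fun x y => ⁅x, w ![y]⁆ - ⁅y, w ![x]⁆ - w ![⁅x, y⁆])
    (fun x x' y => by simp only [w.add₁, add_lie, lie_add]; ring)
    (fun f x y => by
      have h : ⁅f • x, y⁆ = f • ⁅x, y⁆ - ⁅y, f⁆ • x := by
        rw [← lie_skew, LieRinehartRing.leibniz_smul_right' (A := C), ← lie_skew x y, smul_neg]
        abel
      simp only [h, sub_eq_add_neg, ← neg_smul, w.smul₁, w.add₁,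
        LieRinehartRing.lie_smul_eq_mul, LieRinehartRing.leibniz_mul_right, smul_eq_mul]
      ring)
    (fun x => by
      have : w ![0] = 0 := by simpa using w.smul₁ 0 0
      simp [this])
    (fun x y => by
      have : w ![⁅x, y⁆] = -w ![⁅y, x⁆] := by
        rw [← lie_skew, ← neg_one_smul C, w.smul₁]; ring
      rw [this]; ring)

/-- The exterior derivative of a `2`-form:
`dw(x,y,z) = x(w(y,z)) - y(w(x,z)) + z(w(x,y)) - w([x,y],z) + w([x,z],y) - w([y,z],x)`. -/
def d₂ (w : Form C X 2) : Form C X 3 :=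
  Form.mk₃ (fun x y z => ⁅x, w ![y, z]⁆ - ⁅y, w ![x, z]⁆ + ⁅z, w ![x, y]⁆
      - w ![⁅x, y⁆, z] + w ![⁅x, z⁆, y] - w ![⁅y, z⁆, x])
    (fun x x' y z => by simp only [w.add₂, w.add₂', add_lie, lie_add]; ring)
    (fun f x y z => by
      have h : ∀ y, ⁅f • x, y⁆ = f • ⁅x, y⁆ - ⁅y, f⁆ • x := by
        intro y
        rw [← lie_skew, LieRinehartRing.leibniz_smul_right' (A := C), ← lie_skew x y, smul_neg]
        abel
      simp only [h, sub_eq_add_neg, ← neg_smul, w.smul₂, w.smul₂', w.add₂,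
        LieRinehartRing.lie_smul_eq_mul, LieRinehartRing.leibniz_mul_right, smul_eq_mul]
      rw [w.swap₂ x y]
      ring)
    (fun x z => by
      have : w ![0, z] = 0 := by simpa using w.smul₂ 0 0 z
      simp [this, w.self₂])
    (fun x y z => by
      have : w ![⁅x, y⁆, z] = -w ![⁅y, x⁆, z] := by
        rw [← lie_skew, ← neg_one_smul C, w.smul₂]; ring
      rw [this, w.swap₂ x y, lie_neg]; ring)
    (fun x y z => by
      have : w ![⁅y, z⁆, x] = -w ![⁅z, y⁆, x] := by
        rw [← lie_skew, ← neg_one_smul C, w.smul₂]; ring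
      rw [this, w.swap₂ y z, lie_neg]; ring)

/-- The Lie derivative of a `1`-form: `(L_x w)(y) = x(w(y)) - w([x,y])`. -/
def L₁ (x : X) (w : Form C X 1) : Form C X 1 :=
  Form.mk₁
    { toFun := fun y => ⁅x, w ![y]⁆ - w ![⁅x, y⁆]
      map_add' := fun y z => by simp only [w.add₁, lie_add]; ring
      map_smul' := fun f y => by
        simp only [LieRinehartRing.leibniz_smul_right' (A := C), w.add₁, w.smul₁,
          LieRinehartRing.leibniz_mul_right, smul_eq_mul, RingHom.id_apply]
        ring }

/-- The Lie derivative of a `2`-form: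
`(L_x w)(y,z) = x(w(y,z)) - w([x,y],z) - w(y,[x,z])`. -/
def L₂ (x : X) (w : Form C X 2) : Form C X 2 :=
  Form.mk₂ (fun y z => ⁅x, w ![y, z]⁆ - w ![⁅x, y⁆, z] - w ![y, ⁅x, z⁆])
    (fun y y' z => by simp only [w.add₂, lie_add]; ring)
    (fun f y z => by
      simp only [LieRinehartRing.leibniz_smul_right' (A := C), w.add₂, w.smul₂,
        LieRinehartRing.leibniz_mul_right, smul_eq_mul]
      ring)
    (fun y => by rw [w.swap₂ y ⁅x, y⁆]; simp [w.self₂])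
    (fun y z => by rw [w.swap₂ y z, w.swap₂ ⁅x, y⁆ z, w.swap₂ y ⁅x, z⁆, lie_neg]; ring)

/-- The wedge product of `df` and a `1`-form: `(df ∧ w)(x,y) = x(f) w(y) - y(f) w(x)`. -/
def dWedge₁ (f : C) (w : Form C X 1) : Form C X 2 :=
  Form.mk₂ (fun x y => ⁅x, f⁆ * w ![y] - ⁅y, f⁆ * w ![x])
    (fun x x' y => by simp only [w.add₁, add_lie]; ring)
    (fun g x y => by simp only [w.smul₁, LieRinehartRing.lie_smul_eq_mul]; ring)
    (fun x => by ring) (fun x y => by ring)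

/-- The wedge product of `df` and a `2`-form:
`(df ∧ w)(x,y,z) = x(f) w(y,z) - y(f) w(x,z) + z(f) w(x,y)`. -/
def dWedge₂ (f : C) (w : Form C X 2) : Form C X 3 :=
  Form.mk₃ (fun x y z => ⁅x, f⁆ * w ![y, z] - ⁅y, f⁆ * w ![x, z] + ⁅z, f⁆ * w ![x, y])
    (fun x x' y z => by simp only [w.add₂, add_lie]; ring)
    (fun g x y z => by simp only [w.smul₂, LieRinehartRing.lie_smul_eq_mul]; ring)
    (fun x z => by rw [w.self₂]; ring)
    (fun x y z => by rw [w.swap₂ x y]; ring)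
    (fun x y z => by rw [w.swap₂ y z]; ring)

@[simp] theorem d₀_apply (f : C) (x : X) : d₀ f ![x] = ⁅x, f⁆ := rfl

@[simp] theorem d₁_apply (w : Form C X 1) (x y : X) :
    d₁ w ![x, y] = ⁅x, w ![y]⁆ - ⁅y, w ![x]⁆ - w ![⁅x, y⁆] := rfl

@[simp] theorem d₂_apply (w : Form C X 2) (x y z : X) :
    d₂ w ![x, y, z] = ⁅x, w ![y, z]⁆ - ⁅y, w ![x, z]⁆ + ⁅z, w ![x, y]⁆
      - w ![⁅x, y⁆, z] + w ![⁅x, z⁆, y] - w ![⁅y, z⁆, x] := rfl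

@[simp] theorem L₁_apply (x : X) (w : Form C X 1) (y : X) :
    L₁ x w ![y] = ⁅x, w ![y]⁆ - w ![⁅x, y⁆] := rfl

@[simp] theorem L₂_apply (x : X) (w : Form C X 2) (y z : X) :
    L₂ x w ![y, z] = ⁅x, w ![y, z]⁆ - w ![⁅x, y⁆, z] - w ![y, ⁅x, z⁆] := rfl

@[simp] theorem dWedge₁_apply (f : C) (w : Form C X 1) (x y : X) :
    dWedge₁ f w ![x, y] = ⁅x, f⁆ * w ![y] - ⁅y, f⁆ * w ![x] := rfl

@[simp] theorem dWedge₂_apply (f : C) (w : Form C X 2) (x y z : X) :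
    dWedge₂ f w ![x, y, z] =
      ⁅x, f⁆ * w ![y, z] - ⁅y, f⁆ * w ![x, z] + ⁅z, f⁆ * w ![x, y] := rfl

/-! Linearity and Leibniz rules -/

theorem d₁_add (w w' : Form C X 1) : d₁ (w + w') = d₁ w + d₁ w' := by
  apply Form.ext₂; intro x y
  simp only [d₁_apply, AlternatingMap.add_apply, lie_add]; ring

theorem d₁_smul (f : C) (w : Form C X 1) : d₁ (f • w) = dWedge₁ f w + f • d₁ w := by
  apply Form.ext₂; intro x y
  simp only [d₁_apply, dWedge₁_apply, AlternatingMap.add_apply, AlternatingMap.smul_apply,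
    LieRinehartRing.leibniz_mul_right, smul_eq_mul]
  ring

theorem d₂_add (w w' : Form C X 2) : d₂ (w + w') = d₂ w + d₂ w' := by
  apply Form.ext₃; intro x y z
  simp only [d₂_apply, AlternatingMap.add_apply, lie_add]; ring

theorem d₂_smul (f : C) (w : Form C X 2) : d₂ (f • w) = dWedge₂ f w + f • d₂ w := by
  apply Form.ext₃; intro x y z
  simp only [d₂_apply, dWedge₂_apply, AlternatingMap.add_apply, AlternatingMap.smul_apply,
    LieRinehartRing.leibniz_mul_right, smul_eq_mul]
  ring

theorem d₂_sub (w w' : Form C X 2) : d₂ (w - w') = d₂ w - d₂ w' := by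
  apply Form.ext₃; intro x y z
  simp only [d₂_apply, AlternatingMap.sub_apply, lie_sub]; ring

theorem d₂_dWedge₁ (f : C) (w : Form C X 1) : d₂ (dWedge₁ f w) = -dWedge₂ f (d₁ w) := by
  apply Form.ext₃; intro x y z
  have h : ∀ x y : X, ⁅⁅x, y⁆, f⁆ = ⁅x, ⁅y, f⁆⁆ - ⁅y, ⁅x, f⁆⁆ := fun x y => lie_lie x y f
  simp only [d₂_apply, dWedge₂_apply, dWedge₁_apply, d₁_apply, AlternatingMap.neg_apply,
    LieRinehartRing.leibniz_mul_right, lie_sub, smul_eq_mul, h]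
  ring

theorem L₁_add (x : X) (w w' : Form C X 1) : L₁ x (w + w') = L₁ x w + L₁ x w' := by
  apply Form.ext₁; intro y
  simp only [L₁_apply, AlternatingMap.add_apply, lie_add]; ring

theorem L₁_smul (x : X) (f : C) (w : Form C X 1) :
    L₁ x (f • w) = ⁅x, f⁆ • w + f • L₁ x w := by
  apply Form.ext₁; intro y
  simp only [L₁_apply, AlternatingMap.add_apply, AlternatingMap.smul_apply,
    LieRinehartRing.leibniz_mul_right, smul_eq_mul]
  ring

theorem smul_lie' (f : C) (x y : X) : ⁅f • x, y⁆ = f • ⁅x, y⁆ + (-⁅y, f⁆) • x := by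
  rw [← lie_skew, LieRinehartRing.leibniz_smul_right' (A := C), ← lie_skew x y, smul_neg, neg_smul]
  abel

theorem L₁_add_left (x x' : X) (w : Form C X 1) : L₁ (x + x') w = L₁ x w + L₁ x' w := by
  apply Form.ext₁; intro y
  simp only [L₁_apply, AlternatingMap.add_apply, add_lie, w.add₁]; ring

theorem L₁_smul_left (x : X) (f : C) (w : Form C X 1) :
    L₁ (f • x) w = f • L₁ x w + w ![x] • d₀ f := by
  apply Form.ext₁; intro y
  simp only [L₁_apply, d₀_apply, AlternatingMap.add_apply, AlternatingMap.smul_apply,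
    smul_lie', w.add₁, w.smul₁, LieRinehartRing.lie_smul_eq_mul, smul_eq_mul]
  ring

theorem L₂_add (x : X) (w w' : Form C X 2) : L₂ x (w + w') = L₂ x w + L₂ x w' := by
  apply Form.ext₂; intro y z
  simp only [L₂_apply, AlternatingMap.add_apply, lie_add]; ring

theorem L₂_sub (x : X) (w w' : Form C X 2) : L₂ x (w - w') = L₂ x w - L₂ x w' := by
  apply Form.ext₂; intro y z
  simp only [L₂_apply, AlternatingMap.sub_apply, lie_sub]; ring

theorem L₂_smul (x : X) (f : C) (w : Form C X 2) :
    L₂ x (f • w) = ⁅x, f⁆ • w + f • L₂ x w := by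
  apply Form.ext₂; intro y z
  simp only [L₂_apply, AlternatingMap.add_apply, AlternatingMap.smul_apply,
    LieRinehartRing.leibniz_mul_right, smul_eq_mul]
  ring

theorem L₂_add_left (x x' : X) (w : Form C X 2) : L₂ (x + x') w = L₂ x w + L₂ x' w := by
  apply Form.ext₂; intro y z
  simp only [L₂_apply, AlternatingMap.add_apply, add_lie, w.add₂, w.add₂']; ring

theorem L₂_smul_left (x : X) (f : C) (w : Form C X 2) :
    L₂ (f • x) w = f • L₂ x w + dWedge₁ f (ι x w) := by
  apply Form.ext₂; intro y z
  simp only [L₂_apply, dWedge₁_apply, ι_apply, AlternatingMap.add_apply,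
    AlternatingMap.smul_apply, smul_lie', w.add₂, w.smul₂, w.add₂', w.smul₂',
    LieRinehartRing.lie_smul_eq_mul, smul_eq_mul]
  rw [w.swap₂ y x]
  ring

theorem L₂_dWedge₁ (x : X) (f : C) (w : Form C X 1) :
    L₂ x (dWedge₁ f w) = dWedge₁ ⁅x, f⁆ w + dWedge₁ f (L₁ x w) := by
  apply Form.ext₂; intro y z
  have h : ∀ x y : X, ⁅⁅x, y⁆, f⁆ = ⁅x, ⁅y, f⁆⁆ - ⁅y, ⁅x, f⁆⁆ := fun x y => lie_lie x y f
  simp only [L₂_apply, dWedge₁_apply, L₁_apply, AlternatingMap.add_apply,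
    LieRinehartRing.leibniz_mul_right, lie_sub, smul_eq_mul, h]
  ring

theorem ι_dWedge₁ (x : X) (f : C) (w : Form C X 1) :
    ι x (dWedge₁ f w) = ⁅x, f⁆ • w - w ![x] • d₀ f := by
  apply Form.ext₁; intro y
  simp only [ι_apply, dWedge₁_apply, d₀_apply, AlternatingMap.sub_apply,
    AlternatingMap.smul_apply, smul_eq_mul]
  ring

theorem dWedge₁_add (f : C) (w w' : Form C X 1) :
    dWedge₁ f (w + w') = dWedge₁ f w + dWedge₁ f w' := by
  apply Form.ext₂; intro x y
  simp only [dWedge₁_apply, AlternatingMap.add_apply]; ring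

theorem dWedge₁_sub (f : C) (w w' : Form C X 1) :
    dWedge₁ f (w - w') = dWedge₁ f w - dWedge₁ f w' := by
  apply Form.ext₂; intro x y
  simp only [dWedge₁_apply, AlternatingMap.sub_apply]; ring

theorem dWedge₂_add (f : C) (w w' : Form C X 2) :
    dWedge₂ f (w + w') = dWedge₂ f w + dWedge₂ f w' := by
  apply Form.ext₃; intro x y z
  simp only [dWedge₂_apply, AlternatingMap.add_apply]; ring

section Scalars

variable [Algebra ℝ C] [LieAlgebra ℝ X] [LieRinehartAlgebra ℝ C X]

theorem smulR_eq (r : ℝ) {k : ℕ} (w : Form C X k) : r • w = algebraMap ℝ C r • w := by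
  ext v; simp [Algebra.smul_def]

instance (k : ℕ) : IsScalarTower ℝ C (Form C X k) where
  smul_assoc r f w := by ext v; exact smul_assoc r f (w v)

theorem lie_algebraMap (x : X) (r : ℝ) : ⁅x, algebraMap ℝ C r⁆ = 0 :=
  (LieRinehartAlgebra.anchor ℝ C X x).map_algebraMap r

theorem dWedge₁_algebraMap (r : ℝ) (w : Form C X 1) : dWedge₁ (algebraMap ℝ C r) w = 0 := by
  apply Form.ext₂; intro x y; simp [lie_algebraMap]

theorem d₁_smulR (r : ℝ) (w : Form C X 1) : d₁ (r • w) = r • d₁ w := by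
  rw [smulR_eq, smulR_eq, d₁_smul, dWedge₁_algebraMap, zero_add]

theorem d₂_smulR (r : ℝ) (w : Form C X 2) : d₂ (r • w) = r • d₂ w := by
  rw [smulR_eq, smulR_eq, d₂_smul, add_eq_right]
  apply Form.ext₃; intro x y z; simp [lie_algebraMap]

theorem L₁_smulR (x : X) (r : ℝ) (w : Form C X 1) : L₁ x (r • w) = r • L₁ x w := by
  rw [smulR_eq, smulR_eq, L₁_smul, lie_algebraMap, zero_smul, zero_add]

theorem L₂_smulR (x : X) (r : ℝ) (w : Form C X 2) : L₂ x (r • w) = r • L₂ x w := by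
  rw [smulR_eq, smulR_eq, L₂_smul, lie_algebraMap, zero_smul, zero_add]

theorem L₁_smulR_left (x : X) (r : ℝ) (w : Form C X 1) : L₁ (r • x) w = r • L₁ x w := by
  rw [← algebraMap_smul C r x, L₁_smul_left, smulR_eq, add_eq_left]
  apply Form.ext₁; intro y; simp [lie_algebraMap]

theorem L₂_smulR_left (x : X) (r : ℝ) (w : Form C X 2) : L₂ (r • x) w = r • L₂ x w := by
  rw [← algebraMap_smul C r x, L₂_smul_left, dWedge₁_algebraMap, smulR_eq, add_zero]

theorem ι_smulR (x : X) (r : ℝ) (w : Form C X 2) : ι x (r • w) = r • ι x w := rfl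

end Scalars

end Cartan

/-! ### The intrinsic Weil algebra

`G` plays the role of the sections of the Lie algebroid. Elements of `Ω^k(M; A^*)` are
`C`-linear maps `G → Ω^k(M)`, and elements of `Ω^0(M; S²(A^*))` are symmetric `C`-bilinear maps
`G × G → C`. -/

section Weil

variable (C X G : Type*) [CommRing C] [Algebra ℝ C] [LieRing X] [LieAlgebra ℝ X] [Module C X]
  [LieRingModule X C] [LieRinehartRing C X] [LieRinehartAlgebra ℝ C X]
  [AddCommGroup G] [Module ℝ G] [Module C G] [IsScalarTower ℝ C G]

/-- A Lie bracket and an anchor on a module of sections, satisfying the Leibniz identity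
`[α, fβ] = f[α, β] + ρ(α)(f)β`. -/
structure AlgebroidBracket where
  ρ : G →ₗ[C] X
  bracket : G →ₗ[ℝ] G →ₗ[ℝ] G
  bracket_self : ∀ α, bracket α α = 0
  jacobi : ∀ α β γ,
    bracket α (bracket β γ) = bracket (bracket α β) γ + bracket β (bracket α γ)
  leibniz : ∀ (α β : G) (f : C), bracket α (f • β) = f • bracket α β + ⁅ρ α, f⁆ • β

/-- `W^{1,2}`: pairs `(c₀, c₁)` of an `ℝ`-linear map `c₀ : Γ(A) → Ω²(M)` and
`c₁ ∈ Ω¹(M; A^*)` with `c₀(fα) = f c₀(α) - df ∧ c₁(α)`. -/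
@[ext]
structure Weil₁₂ where
  c₀ : G →ₗ[ℝ] Form C X 2
  c₁ : G →ₗ[C] Form C X 1
  compat : ∀ (f : C) α, c₀ (f • α) = f • c₀ α - dWedge₁ f (c₁ α)

/-- `W^{1,3}`: pairs `(c₀, c₁)` of an `ℝ`-linear map `c₀ : Γ(A) → Ω³(M)` and
`c₁ ∈ Ω²(M; A^*)` with `c₀(fα) = f c₀(α) - df ∧ c₁(α)`. -/
@[ext]
structure Weil₁₃ where
  c₀ : G →ₗ[ℝ] Form C X 3
  c₁ : G →ₗ[C] Form C X 2
  compat : ∀ (f : C) α, c₀ (f • α) = f • c₀ α - dWedge₂ f (c₁ α)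

/-- `W^{2,2}`: triples `(c₀, c₁, c₂)` of an antisymmetric `ℝ`-bilinear map
`c₀ : Γ(A) × Γ(A) → Ω²(M)`, an `ℝ`-linear map `c₁ : Γ(A) → Ω¹(M; A^*)` and
`c₂ ∈ Ω⁰(M; S²(A^*))` with
`c₀(α, fβ) = f c₀(α, β) - df ∧ c₁(α)(β)` and `c₁(fα)(β) = f c₁(α)(β) - c₂(α, β) df`. -/
@[ext]
structure Weil₂₂ where
  c₀ : G →ₗ[ℝ] G →ₗ[ℝ] Form C X 2
  c₁ : G →ₗ[ℝ] G →ₗ[C] Form C X 1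
  c₂ : G →ₗ[C] G →ₗ[C] C
  alt : ∀ α, c₀ α α = 0
  symm : ∀ α β, c₂ α β = c₂ β α
  compat₀ : ∀ (f : C) α β, c₀ α (f • β) = f • c₀ α β - dWedge₁ f (c₁ α β)
  compat₁ : ∀ (f : C) α β, c₁ (f • α) β = f • c₁ α β - c₂ α β • d₀ f

variable {C X G}

instance : Zero (Weil₁₃ C X G) :=
  ⟨⟨0, 0, fun f α => by apply Form.ext₃; intro x y z; simp⟩⟩

instance : Zero (Weil₂₂ C X G) :=
  ⟨⟨0, 0, 0, fun _ => rfl, fun _ _ => rfl,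
    fun f α β => by apply Form.ext₂; intro x y; simp, fun f α β => by simp⟩⟩

namespace AlgebroidBracket

theorem bracket_swap (L : AlgebroidBracket C X G) (α β : G) :
    L.bracket α β = -L.bracket β α := by
  have h := L.bracket_self (α + β)
  simp only [map_add, LinearMap.add_apply, L.bracket_self, zero_add, add_zero] at h
  rw [eq_neg_iff_add_eq_zero, add_comm]; exact h

theorem smul_bracket (L : AlgebroidBracket C X G) (α β : G) (f : C) :
    L.bracket (f • α) β = f • L.bracket α β - ⁅L.ρ β, f⁆ • α := by
  rw [L.bracket_swap, L.leibniz, L.bracket_swap α β, smul_neg]; abel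

theorem ρ_smulR (L : AlgebroidBracket C X G) (r : ℝ) (α : G) : L.ρ (r • α) = r • L.ρ α :=
  L.ρ.map_smul_of_tower r α

end AlgebroidBracket

namespace Weil₁₂

theorem c₁_smulR (c : Weil₁₂ C X G) (r : ℝ) (α : G) : c.c₁ (r • α) = r • c.c₁ α :=
  c.c₁.map_smul_of_tower r α

/-- The vertical differential `W^{1,2} → W^{1,3}`: `(d^{ver}c)₀(α) = -d(c₀(α))`, with
`(d^{ver}c)₁(α) = c₀(α) + d(c₁(α))`. -/
def dVer (c : Weil₁₂ C X G) : Weil₁₃ C X G where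
  c₀ :=
    { toFun := fun α => -d₂ (c.c₀ α)
      map_add' := fun α β => by rw [map_add, d₂_add, neg_add]
      map_smul' := fun r α => by rw [map_smul, d₂_smulR, smul_neg]; rfl }
  c₁ :=
    { toFun := fun α => c.c₀ α + d₁ (c.c₁ α)
      map_add' := fun α β => by rw [map_add, map_add, d₁_add]; abel
      map_smul' := fun f α => by
        rw [c.compat, map_smul, d₁_smul, RingHom.id_apply, smul_add]; abel }
  compat f α := by
    change -d₂ (c.c₀ (f • α)) = f • -d₂ (c.c₀ α) - dWedge₂ f (c.c₀ α + d₁ (c.c₁ α))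
    rw [c.compat, d₂_sub, d₂_smul, d₂_dWedge₁, dWedge₂_add, smul_neg]; abel

/-- The horizontal differential `W^{1,2} → W^{2,2}`:
`(d^{hor}c)₀(α, β) = -c₀([α, β]) + L_{ρ(α)}(c₀(β)) - L_{ρ(β)}(c₀(α))`, with
`(d^{hor}c)₁(α)(β) = -c₁([α, β]) + L_{ρ(α)}(c₁(β)) + i_{ρ(β)}(c₀(α))` and
`(d^{hor}c)₂(α, β) = -i_{ρ(α)}(c₁(β)) - i_{ρ(β)}(c₁(α))`. -/
def dHor (L : AlgebroidBracket C X G) (c : Weil₁₂ C X G) : Weil₂₂ C X G where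
  c₀ := LinearMap.mk₂ ℝ
    (fun α β => -c.c₀ (L.bracket α β) + L₂ (L.ρ α) (c.c₀ β) - L₂ (L.ρ β) (c.c₀ α))
    (fun α α' β => by
      simp only [map_add, LinearMap.add_apply, L₂_add, L₂_add_left, neg_add]; abel)
    (fun r α β => by
      simp only [map_smul, L.ρ_smulR, LinearMap.smul_apply, L₂_smulR,
        L₂_smulR_left, smul_sub, smul_add, smul_neg])
    (fun α β β' => by
      simp only [map_add, L₂_add, L₂_add_left, neg_add]; abel)
    (fun r α β => by
      simp only [map_smul, L.ρ_smulR, L₂_smulR,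
        L₂_smulR_left, smul_sub, smul_add, smul_neg])
  c₁ :=
    { toFun := fun α =>
        { toFun := fun β => -c.c₁ (L.bracket α β) + L₁ (L.ρ α) (c.c₁ β) + ι (L.ρ β) (c.c₀ α)
          map_add' := fun β β' => by
            simp only [map_add, L₁_add, neg_add, ι_add_left]; abel
          map_smul' := fun f β => by
            simp only [L.leibniz, map_add, map_smul, L₁_smul, ι_smul_left, RingHom.id_apply,
              smul_add, smul_neg, neg_add]
            abel }
      map_add' := fun α α' => by
        ext1 β
        simp only [LinearMap.coe_mk, AddHom.coe_mk, map_add, LinearMap.add_apply, L₁_add_left,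
          ι_add, neg_add]
        abel
      map_smul' := fun r α => by
        ext1 β
        simp only [LinearMap.coe_mk, AddHom.coe_mk, map_smul, c.c₁_smulR, L.ρ_smulR,
          LinearMap.smul_apply, L₁_smulR_left, ι_smulR, RingHom.id_apply, smul_add, smul_neg] }
  c₂ := LinearMap.mk₂ C (fun α β => -c.c₁ β ![L.ρ α] - c.c₁ α ![L.ρ β])
    (fun α α' β => by
      simp only [map_add, Form.add₁, AlternatingMap.add_apply]; ring)
    (fun f α β => by
      simp only [map_smul, Form.smul₁, AlternatingMap.smul_apply, smul_eq_mul]; ring)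
    (fun α β β' => by
      simp only [map_add, Form.add₁, AlternatingMap.add_apply]; ring)
    (fun f α β => by
      simp only [map_smul, Form.smul₁, AlternatingMap.smul_apply, smul_eq_mul]; ring)
  alt α := by
    simp [L.bracket_self]
  symm α β := by
    simp only [LinearMap.mk₂_apply]; ring
  compat₀ f α β := by
    change -c.c₀ (L.bracket α (f • β)) + L₂ (L.ρ α) (c.c₀ (f • β)) - L₂ (L.ρ (f • β)) (c.c₀ α) =
      f • (-c.c₀ (L.bracket α β) + L₂ (L.ρ α) (c.c₀ β) - L₂ (L.ρ β) (c.c₀ α)) -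
        dWedge₁ f (-c.c₁ (L.bracket α β) + L₁ (L.ρ α) (c.c₁ β) + ι (L.ρ β) (c.c₀ α))
    rw [L.leibniz, map_add, c.compat, c.compat, c.compat, map_smul, L₂_smul_left, L₂_sub,
      L₂_smul, L₂_dWedge₁, neg_add_eq_sub (c.c₁ _), dWedge₁_add, dWedge₁_sub, smul_sub, smul_add,
      smul_neg]
    abel
  compat₁ f α β := by
    change -c.c₁ (L.bracket (f • α) β) + L₁ (L.ρ (f • α)) (c.c₁ β) + ι (L.ρ β) (c.c₀ (f • α)) =
      f • (-c.c₁ (L.bracket α β) + L₁ (L.ρ α) (c.c₁ β) + ι (L.ρ β) (c.c₀ α)) -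
        (-c.c₁ β ![L.ρ α] - c.c₁ α ![L.ρ β]) • d₀ f
    have h : ∀ a b : C, (-a - b) • (d₀ f : Form C X 1) = -(a • d₀ f) - b • d₀ f := fun a b => by
      apply Form.ext₁; intro x; simp; ring
    rw [h, L.smul_bracket, map_sub, map_smul, map_smul, map_smul, L₁_smul_left, c.compat, ι_sub,
      ι_smul, ι_dWedge₁, smul_add, smul_add, smul_neg]
    abel

/-- The element `(-dσ, σ)` of `W^{1,2}` defined by `σ ∈ Ω¹(M; A^*)`: its components are
`c₀(α) = -d(σ(α))` and `c₁ = σ`. -/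
def ofLinearMap (σ : G →ₗ[C] Form C X 1) : Weil₁₂ C X G where
  c₀ :=
    { toFun := fun α => -d₁ (σ α)
      map_add' := fun α β => by rw [map_add, d₁_add, neg_add]
      map_smul' := fun r α => by
        rw [LinearMap.map_smul_of_tower, d₁_smulR, smul_neg]; rfl }
  c₁ := σ
  compat f α := by
    change -d₁ (σ (f • α)) = f • -d₁ (σ α) - dWedge₁ f (σ α)
    rw [map_smul, d₁_smul, smul_neg]; abel

end Weil₁₂

end Weil


/-! ### Smooth functions, sections and vector fields -/

noncomputable section Geometry

section Sections

variable {E : Type*} [NormedAddCommGroup E] [NormedSpace ℝ E]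
  {H : Type*} [TopologicalSpace H] {I : ModelWithCorners ℝ E H}
  {M : Type*} [TopologicalSpace M] [ChartedSpace H M]
  {F : Type*} [NormedAddCommGroup F] [NormedSpace ℝ F]
  {A : M → Type*} [TopologicalSpace (TotalSpace F A)]
  [∀ x, AddCommGroup (A x)] [∀ x, Module ℝ (A x)] [∀ x, TopologicalSpace (A x)]
  [FiberBundle F A] [VectorBundle ℝ F A]

instance : SMul C^∞⟮I, M; ℝ⟯ Cₛ^∞⟮I; F, A⟯ where
  smul f s := ⟨fun x => f x • s x, f.contMDiff.smul_section s.contMDiff⟩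

@[simp] theorem section_smul_apply (f : C^∞⟮I, M; ℝ⟯) (s : Cₛ^∞⟮I; F, A⟯) (x : M) :
    (f • s) x = f x • s x := rfl

/-- Smooth sections of a vector bundle form a module over the smooth functions. -/
instance : Module C^∞⟮I, M; ℝ⟯ Cₛ^∞⟮I; F, A⟯ where
  one_smul s := by ext x; exact one_smul _ _
  mul_smul f g s := by ext x; exact mul_smul _ _ _
  smul_zero f := by ext x; exact smul_zero _
  smul_add f s t := by ext x; exact smul_add _ _ _
  add_smul f g s := by ext x; exact add_smul _ _ _
  zero_smul s := by ext x; exact zero_smul _ _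

instance : IsScalarTower ℝ C^∞⟮I, M; ℝ⟯ Cₛ^∞⟮I; F, A⟯ where
  smul_assoc r f s := by ext x; exact smul_assoc r (f x) (s x)

end Sections

section VectorFields

variable {E : Type*} [NormedAddCommGroup E] [NormedSpace ℝ E] [FiniteDimensional ℝ E]
  {H : Type*} [TopologicalSpace H] {I : ModelWithCorners ℝ E H}
  {M : Type*} [TopologicalSpace M] [ChartedSpace H M] [IsManifold I ∞ M]

/-- Smooth vector fields on `M`. -/
abbrev VF {E : Type*} [NormedAddCommGroup E] [NormedSpace ℝ E] {H : Type*} [TopologicalSpace H]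
    (I : ModelWithCorners ℝ E H) (M : Type*) [TopologicalSpace M] [ChartedSpace H M]
    [IsManifold I ∞ M] : Type _ :=
  Cₛ^∞⟮I; E, (TangentSpace I : M → Type _)⟯

theorem fun_mdiff (f : C^∞⟮I, M; ℝ⟯) (x : M) : MDifferentiableAt I 𝓘(ℝ, ℝ) f x :=
  f.contMDiff.mdifferentiableAt (by simp)

theorem vf_mdiff (V : VF I M) (x : M) :
    MDifferentiableAt I (I.prod 𝓘(ℝ, E)) (fun y => (⟨y, V y⟩ : TangentBundle I M)) x :=
  V.contMDiff.mdifferentiableAt (by simp)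

/-- The action `V(f) = df(V)` of a vector field on a function. -/
instance : Bracket (VF I M) C^∞⟮I, M; ℝ⟯ where
  bracket V f := ⟨fun x => mvfderiv I f x (V x), by
    have h : ContMDiff I (𝓘(ℝ, ℝ).tangent) ∞
        (fun x => tangentMap I 𝓘(ℝ, ℝ) f (⟨x, V x⟩ : TangentBundle I M)) :=
      (f.contMDiff.contMDiff_tangentMap (m := ∞) (by simp)).comp V.contMDiff
    exact (contMDiff_snd_tangentBundle_modelSpace ℝ 𝓘(ℝ, ℝ)).comp h⟩

theorem lie_fun_apply (V : VF I M) (f : C^∞⟮I, M; ℝ⟯) (x : M) :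
    (⁅V, f⁆ : C^∞⟮I, M; ℝ⟯) x = mvfderiv I f x (V x) := rfl

instance : Bracket (VF I M) (VF I M) where
  bracket V W := ⟨mlieBracket I V W, by
    have : IsManifold I (minSmoothness ℝ 2) M := by
      rw [minSmoothness_of_isRCLikeNormedField]; infer_instance
    have : IsManifold I (((⊤ : ℕ∞) : WithTop ℕ∞) + 1) M := by
      change IsManifold I ∞ M; infer_instance
    exact ContDiff.mlieBracket_vectorField (n := ⊤) (m := ⊤) V.contMDiff W.contMDiff (by simp)⟩

theorem lie_vf_apply (V W : VF I M) (x : M) : (⁅V, W⁆ : VF I M) x = mlieBracket I V W x := rfl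

/-- Smooth vector fields form a Lie ring under the Lie bracket. -/
instance : LieRing (VF I M) where
  add_lie U V W := by
    ext x; exact mlieBracket_add_left (vf_mdiff U x) (vf_mdiff V x)
  lie_add U V W := by
    ext x; exact mlieBracket_add_right (vf_mdiff V x) (vf_mdiff W x)
  lie_self V := by
    ext x; simp [lie_vf_apply]
  leibniz_lie U V W := by
    ext x
    have : IsManifold I (minSmoothness ℝ 3) M := by
      rw [minSmoothness_of_isRCLikeNormedField]; infer_instance
    have h : ∀ V : VF I M, ContMDiffAt I (I.prod 𝓘(ℝ, E)) (minSmoothness ℝ 2)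
        (fun y => (⟨y, V y⟩ : TangentBundle I M)) x := fun V =>
      (V.contMDiff x).of_le (by
        rw [minSmoothness_of_isRCLikeNormedField]; exact WithTop.coe_le_coe.mpr le_top)
    exact leibniz_identity_mlieBracket_apply (h U) (h V) (h W)

instance : LieAlgebra ℝ (VF I M) where
  lie_smul r V W := by
    ext x; exact mlieBracket_const_smul_right (vf_mdiff W x)

theorem lie_lie_fun (U V : VF I M) (f : C^∞⟮I, M; ℝ⟯) :
    ⁅U, ⁅V, f⁆⁆ = ⁅⁅U, V⁆, f⁆ + ⁅V, ⁅U, f⁆⁆ := by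
  ext x
  have : IsManifold I (minSmoothness ℝ 2) M := by
    rw [minSmoothness_of_isRCLikeNormedField]; infer_instance
  have : IsManifold I (minSmoothness ℝ 3) M := by
    rw [minSmoothness_of_isRCLikeNormedField]; infer_instance
  have : IsManifold I (((2 : ℕ∞) : WithTop ℕ∞) + 1) M :=
    IsManifold.of_le (n := ∞) (by exact_mod_cast le_top)
  by_cases hE : ∀ v : TangentSpace I x, v = 0
  · have h0 : ∀ (W : VF I M) (g : C^∞⟮I, M; ℝ⟯), (⁅W, g⁆ : C^∞⟮I, M; ℝ⟯) x = 0 := fun W g => by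
      rw [lie_fun_apply, hE (W x), map_zero]
    rw [ContMDiffMap.coe_add, Pi.add_apply, h0, h0, h0, add_zero]
  push Not at hE
  obtain ⟨v, hv⟩ := hE
  let Z : ∀ y : M, TangentSpace I y := FiberBundle.extend E v
  have hZx : Z x = v := by simp [Z]
  have hZ : ContMDiffAt I (I.prod 𝓘(ℝ, E)) 2 (fun y => (⟨y, Z y⟩ : TangentBundle I M)) x :=
    FiberBundle.contMDiffAt_extend I E v
  have hZm : ∀ᶠ y in nhds x,
      MDifferentiableAt I (I.prod 𝓘(ℝ, E)) (fun y => (⟨y, Z y⟩ : TangentBundle I M)) y :=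
    by
      obtain ⟨s, hs, hZs⟩ := FiberBundle.exists_mdifferentiableOn_extend I E v
      filter_upwards [eventually_mem_nhds_iff.mpr hs] with y hy
      exact (hZs y (mem_of_mem_nhds hy)).mdifferentiableAt hy
  have hW : ∀ W : VF I M, ContMDiffAt I (I.prod 𝓘(ℝ, E)) 2
      (fun y => (⟨y, W y⟩ : TangentBundle I M)) x := fun W =>
    (W.contMDiff x).of_le (WithTop.coe_le_coe.mpr le_top)
  have hf : ContMDiffAt I 𝓘(ℝ, ℝ) 2 f x := (f.contMDiff x).of_le (WithTop.coe_le_coe.mpr le_top)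
  have hWZ : ∀ W : VF I M, MDifferentiableAt I (I.prod 𝓘(ℝ, E))
      (fun y => (⟨y, mlieBracket I W Z y⟩ : TangentBundle I M)) x := fun W =>
    (ContMDiffAt.mlieBracket_vectorField (n := 2) (m := 1) (hW W) hZ
      (by rw [minSmoothness_of_isRCLikeNormedField]; norm_num)).mdifferentiableAt (by simp)
  have key : ∀ W W' : VF I M, mlieBracket I W (mlieBracket I W' (⇑f • Z)) x =
      ((⁅W, ⁅W', f⁆⁆ : C^∞⟮I, M; ℝ⟯) x • v + (⁅W', f⁆ : C^∞⟮I, M; ℝ⟯) x • mlieBracket I W Z x) +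
      ((⁅W, f⁆ : C^∞⟮I, M; ℝ⟯) x • mlieBracket I W' Z x +
        f x • mlieBracket I W (mlieBracket I W' Z) x) := by
    intro W W'
    have h : mlieBracket I W' (⇑f • Z) =ᶠ[nhds x]
        ⇑(⁅W', f⁆ : C^∞⟮I, M; ℝ⟯) • Z + ⇑f • mlieBracket I W' Z := by
      filter_upwards [hZm] with y hy
      exact mlieBracket_smul_right (fun_mdiff f y) hy
    refine (Filter.EventuallyEq.mlieBracket_vectorField_eq
      (Filter.EventuallyEq.refl (nhds x) (⇑W)) h).trans ?_
    rw [mlieBracket_add_right, mlieBracket_smul_right (fun_mdiff _ x) hZm.self_of_nhds,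
      mlieBracket_smul_right (fun_mdiff _ x) (hWZ W'), hZx]
    · rfl
    · exact (fun_mdiff _ x).smul_section hZm.self_of_nhds
    · exact (fun_mdiff _ x).smul_section (hWZ W')
  have e2 : minSmoothness ℝ 2 = 2 := minSmoothness_of_isRCLikeNormedField
  have j₁ := leibniz_identity_mlieBracket_apply (I := I) (x := x) (U := U) (V := V) (W := Z)
    (by rw [e2]; exact hW U) (by rw [e2]; exact hW V) (by rw [e2]; exact hZ)
  have j₂ := leibniz_identity_mlieBracket_apply (I := I) (x := x) (U := U) (V := V) (W := ⇑f • Z)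
    (by rw [e2]; exact hW U) (by rw [e2]; exact hW V) (by rw [e2]; exact hf.smul_section hZ)
  have j₃ : mlieBracket I (mlieBracket I U V) (⇑f • Z) x =
      (⁅⁅U, V⁆, f⁆ : C^∞⟮I, M; ℝ⟯) x • v + f x • mlieBracket I (mlieBracket I U V) Z x := by
    rw [mlieBracket_smul_right (fun_mdiff f x) hZm.self_of_nhds, hZx]; rfl
  rw [key, key, j₃, j₁] at j₂
  have : ((⁅U, ⁅V, f⁆⁆ : C^∞⟮I, M; ℝ⟯) x - ((⁅⁅U, V⁆, f⁆ : C^∞⟮I, M; ℝ⟯) x +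
      (⁅V, ⁅U, f⁆⁆ : C^∞⟮I, M; ℝ⟯) x)) • v = 0 := by
    rw [sub_smul, add_smul, sub_eq_zero]
    rw [← sub_eq_zero] at j₂ ⊢
    rw [← j₂, smul_add]
    abel
  exact sub_eq_zero.mp ((smul_eq_zero.mp this).resolve_right hv)

instance : LieRingModule (VF I M) C^∞⟮I, M; ℝ⟯ where
  add_lie U V f := by
    ext x; exact map_add (mvfderiv I f x) (U x) (V x)
  lie_add V f g := by
    ext x
    change mvfderiv I (⇑f + ⇑g) x (V x) = _
    rw [mvfderiv_add (fun_mdiff f x) (fun_mdiff g x)]; rfl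
  leibniz_lie := lie_lie_fun

instance : LieRinehartRing C^∞⟮I, M; ℝ⟯ (VF I M) where
  lie_smul_eq_mul' f g V := by
    ext x; exact map_smul (mvfderiv I g x) (f x) (V x)
  leibniz_mul_right' V f g := by
    ext x
    change mvfderiv I (⇑f * ⇑g) x (V x) = _
    rw [mvfderiv_mul (fun_mdiff f x) (fun_mdiff g x)]
    change f x * mvfderiv I g x (V x) + g x * mvfderiv I f x (V x) =
      f x * mvfderiv I g x (V x) + mvfderiv I f x (V x) * g x
    ring
  leibniz_smul_right' V W f := by
    ext x
    refine (mlieBracket_smul_right (fun_mdiff f x) (vf_mdiff W x)).trans ?_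
    exact add_comm _ _

/-- The vector fields on a manifold form a Lie-Rinehart algebra over the smooth functions. -/
instance : LieRinehartAlgebra ℝ C^∞⟮I, M; ℝ⟯ (VF I M) where
  smul_lie r V f := by
    ext x; exact map_smul (mvfderiv I f x) r (V x)
  lie_smul r V f := by
    ext x
    change mvfderiv I (r • ⇑f) x (V x) = r * mvfderiv I f x (V x)
    have := const_smul_mfderiv (fun_mdiff f x) r
    change (mfderiv I 𝓘(ℝ, ℝ) (r • ⇑f) x) (V x) = _
    rw [this]; rfl

end VectorFields


/-! ### Lie algebroids and IM forms -/

section Algebroid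

variable {E : Type*} [NormedAddCommGroup E] [NormedSpace ℝ E] [FiniteDimensional ℝ E]
  {H : Type*} [TopologicalSpace H] {I : ModelWithCorners ℝ E H}
  {M : Type*} [TopologicalSpace M] [ChartedSpace H M] [IsManifold I ∞ M]
  {F : Type*} [NormedAddCommGroup F] [NormedSpace ℝ F]
  {A : M → Type*} [TopologicalSpace (TotalSpace F A)]
  [∀ x, AddCommGroup (A x)] [∀ x, Module ℝ (A x)] [∀ x, TopologicalSpace (A x)]
  [∀ x, IsTopologicalAddGroup (A x)] [∀ x, ContinuousSMul ℝ (A x)]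
  [FiberBundle F A] [VectorBundle ℝ F A]

/-- The `C^∞(M)`-linear map on sections induced by a vector bundle map `A → TM`. -/
def mapSections (φ : Cₛ^∞⟮I; F →L[ℝ] E, fun x : M => A x →L[ℝ] TangentSpace I x⟯) :
    Cₛ^∞⟮I; F, A⟯ →ₗ[C^∞⟮I, M; ℝ⟯] VF I M where
  toFun α := ⟨fun x => φ x (α x), φ.contMDiff.clm_bundle_apply α.contMDiff⟩
  map_add' α β := by ext x; exact map_add (φ x) (α x) (β x)
  map_smul' f α := by ext x; exact map_smul (φ x) (f x) (α x)

/-- The differential `k`-forms on `M`. -/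
abbrev DForm {E : Type*} [NormedAddCommGroup E] [NormedSpace ℝ E] {H : Type*} [TopologicalSpace H]
    (I : ModelWithCorners ℝ E H) (M : Type*) [TopologicalSpace M] [ChartedSpace H M]
    [IsManifold I ∞ M] (k : ℕ) : Type _ :=
  Form C^∞⟮I, M; ℝ⟯ (VF I M) k

/-- Smooth vector bundle maps `σ : A → T^*M` (over the identity of `M`). -/
abbrev CotangentMap {E : Type*} [NormedAddCommGroup E] [NormedSpace ℝ E]
    {H : Type*} [TopologicalSpace H] (I : ModelWithCorners ℝ E H)
    {M : Type*} [TopologicalSpace M] [ChartedSpace H M] [IsManifold I ∞ M]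
    (F : Type*) [NormedAddCommGroup F] [NormedSpace ℝ F]
    (A : M → Type*) [TopologicalSpace (TotalSpace F A)]
    [∀ x, AddCommGroup (A x)] [∀ x, Module ℝ (A x)] [∀ x, TopologicalSpace (A x)]
    [FiberBundle F A] [VectorBundle ℝ F A] : Type _ :=
  Cₛ^∞⟮I; F →L[ℝ] (E →L[ℝ] ℝ), fun x : M => A x →L[ℝ] (TangentSpace I x →L[ℝ] ℝ)⟯

/-- The function `⟨σ(α), V⟩`. -/
def CotangentMap.pairing (σ : CotangentMap I F A) (α : Cₛ^∞⟮I; F, A⟯) (V : VF I M) :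
    C^∞⟮I, M; ℝ⟯ :=
  ⟨fun x => σ x (α x) (V x), by
    have h : ContMDiff I (I.prod 𝓘(ℝ, ℝ)) ∞
        (fun x => TotalSpace.mk' ℝ (E := Bundle.Trivial M ℝ) x (σ x (α x) (V x))) :=
      ContMDiff.clm_bundle_apply₂ (F₁ := F) (F₂ := E) σ.contMDiff α.contMDiff V.contMDiff
    intro x
    exact (contMDiffAt_totalSpace.1 (h x)).2⟩

/-- The `1`-form `σ(α)`, for `σ : A → T^*M` and a section `α` of `A`. -/
def CotangentMap.onSections (σ : CotangentMap I F A) :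
    Cₛ^∞⟮I; F, A⟯ →ₗ[C^∞⟮I, M; ℝ⟯] DForm I M 1 where
  toFun α := Form.mk₁
    { toFun := fun V => σ.pairing α V
      map_add' := fun V W => by ext x; exact map_add (σ x (α x)) (V x) (W x)
      map_smul' := fun f V => by ext x; exact map_smul (σ x (α x)) (f x) (V x) }
  map_add' α β := by
    apply Form.ext₁; intro V; ext x
    exact congrArg (fun l => l (V x)) (map_add (σ x) (α x) (β x))
  map_smul' f α := by
    apply Form.ext₁; intro V; ext x
    exact congrArg (fun l => l (V x)) (map_smul (σ x) (f x) (α x))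

variable (I F A) in
/-- The structure of a Lie algebroid on the vector bundle `A` over `M`: the anchor, which is a
smooth bundle map `A → TM`, and a Lie bracket on the smooth sections of `A` satisfying the Leibniz
identity `[α, fβ] = f[α, β] + ρ(α)(f)β`. -/
structure LieAlgebroid where
  anchorMap : Cₛ^∞⟮I; F →L[ℝ] E, fun x : M => A x →L[ℝ] TangentSpace I x⟯
  bracket : Cₛ^∞⟮I; F, A⟯ →ₗ[ℝ] Cₛ^∞⟮I; F, A⟯ →ₗ[ℝ] Cₛ^∞⟮I; F, A⟯
  bracket_self : ∀ α, bracket α α = 0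
  jacobi : ∀ α β γ,
    bracket α (bracket β γ) = bracket (bracket α β) γ + bracket β (bracket α γ)
  leibniz : ∀ (α β : Cₛ^∞⟮I; F, A⟯) (f : C^∞⟮I, M; ℝ⟯),
    bracket α (f • β) = f • bracket α β + ⁅mapSections anchorMap α, f⁆ • β

namespace LieAlgebroid

/-- The module of sections of a Lie algebroid, with its bracket and anchor. -/
def sections (L : LieAlgebroid I F A) :
    AlgebroidBracket C^∞⟮I, M; ℝ⟯ (VF I M) Cₛ^∞⟮I; F, A⟯ where
  ρ := mapSections L.anchorMap
  bracket := L.bracket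
  bracket_self := L.bracket_self
  jacobi := L.jacobi
  leibniz := L.leibniz

/-- The vector field `ρ(α)`. -/
def ρ (L : LieAlgebroid I F A) (α : Cₛ^∞⟮I; F, A⟯) : VF I M := mapSections L.anchorMap α

/-- `σ : A → T^*M` is an IM form if, for all sections `α, β` of `A`,
`⟨σ(α), ρ(β)⟩ = -⟨σ(β), ρ(α)⟩` and
`σ([α, β]) = L_{ρ(α)}(σ(β)) - L_{ρ(β)}(σ(α)) + d⟨σ(α), ρ(β)⟩`. -/
def IsIMForm (L : LieAlgebroid I F A) (σ : CotangentMap I F A) : Prop :=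
  (∀ α β, σ.pairing α (L.ρ β) = -σ.pairing β (L.ρ α)) ∧
  ∀ α β, σ.onSections (L.bracket α β) =
    L₁ (L.ρ α) (σ.onSections β) - L₁ (L.ρ β) (σ.onSections α) + d₀ (σ.pairing α (L.ρ β))

end LieAlgebroid

variable (I F A) in
/-- The bidegree `(1,2)` part `W^{1,2}(A)` of the intrinsic Weil algebra of `A`. -/
abbrev W₁₂ : Type _ := Weil₁₂ C^∞⟮I, M; ℝ⟯ (VF I M) Cₛ^∞⟮I; F, A⟯

variable (I F A) in
/-- The bidegree `(1,3)` part `W^{1,3}(A)`. -/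
abbrev W₁₃ : Type _ := Weil₁₃ C^∞⟮I, M; ℝ⟯ (VF I M) Cₛ^∞⟮I; F, A⟯

variable (I F A) in
/-- The bidegree `(2,2)` part `W^{2,2}(A)`. -/
abbrev W₂₂ : Type _ := Weil₂₂ C^∞⟮I, M; ℝ⟯ (VF I M) Cₛ^∞⟮I; F, A⟯

/-- The vertical differential `d^{ver} : W^{1,2}(A) → W^{1,3}(A)`. -/
def dVer (c : W₁₂ I F A) : W₁₃ I F A := Weil₁₂.dVer c

/-- The horizontal differential `d^{hor} : W^{1,2}(A) → W^{2,2}(A)`. -/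
def LieAlgebroid.dHor (L : LieAlgebroid I F A) (c : W₁₂ I F A) : W₂₂ I F A :=
  Weil₁₂.dHor L.sections c

/-- The element `(-dσ, σ) = d^{ver}(σ, 0)` of `W^{1,2}(A)` defined by a bundle map
`σ : A → T^*M`. -/
def CotangentMap.toWeil (σ : CotangentMap I F A) : W₁₂ I F A := Weil₁₂.ofLinearMap σ.onSections

end Algebroid

end Geometry

end LieAlgd

namespace LieAlgd

section Extension

variable {E : Type*} [NormedAddCommGroup E] [NormedSpace ℝ E] [FiniteDimensional ℝ E]
  {H : Type*} [TopologicalSpace H] {I : ModelWithCorners ℝ E H}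
  {M : Type*} [TopologicalSpace M] [T2Space M] [ChartedSpace H M] [IsManifold I ∞ M]
  {F : Type*} [NormedAddCommGroup F] [NormedSpace ℝ F] [FiniteDimensional ℝ F]
  {V : M → Type*} [TopologicalSpace (TotalSpace F V)]
  [∀ x, AddCommGroup (V x)] [∀ x, Module ℝ (V x)] [∀ x, TopologicalSpace (V x)]
  [FiberBundle F V] [VectorBundle ℝ F V]

variable (I F V) in
/-- The value of a section at a point, as a linear map. -/
noncomputable def evalSection (x : M) : Cₛ^∞⟮I; F, V⟯ →ₗ[ℝ] V x where
  toFun s := s x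
  map_add' _ _ := rfl
  map_smul' _ _ := rfl

variable [ContMDiffVectorBundle ∞ F V I]

/-- Multiplying a local frame by a bump function gives global sections that agree with the frame
near `x₀`, and that span every section up to a function equal to `1` at `x₀`. -/
theorem exists_global_frame {ι : Type*} [Fintype ι] (b : Module.Basis ι ℝ F) (x₀ : M) :
    ∃ (ψ : C^∞⟮I, M; ℝ⟯) (s : ι → Cₛ^∞⟮I; F, V⟯), ψ x₀ = 1 ∧
      (∀ᶠ x in nhds x₀, ∀ i, s i x = (trivializationAt F V x₀).localFrame b i x) ∧
      ∀ t : Cₛ^∞⟮I; F, V⟯, ∃ c : ι → C^∞⟮I, M; ℝ⟯, ψ • t = ∑ i, c i • s i ∧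
        ∀ i, c i x₀ = (trivializationAt F V x₀).localFrameCoeff I b i x₀ (t x₀) := by
  set e := trivializationAt F V x₀
  have hx₀ : x₀ ∈ e.baseSet := FiberBundle.mem_baseSet_trivializationAt F V x₀
  obtain ⟨φ, hφ⟩ : ∃ φ : SmoothBumpFunction I x₀, tsupport φ ⊆ e.baseSet := by
    obtain ⟨φ, -, h⟩ := (SmoothBumpFunction.nhds_basis_tsupport (I := I) x₀).mem_iff.mp
      (e.open_baseSet.mem_nhds hx₀)
    exact ⟨φ, h⟩
  let s : ι → Cₛ^∞⟮I; F, V⟯ := fun i => ⟨(φ : M → ℝ) • e.localFrame b i,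
    ContMDiffOn.smul_section_of_tsupport φ.contMDiff.contMDiffOn e.open_baseSet hφ
      (e.contMDiffOn_localFrame_baseSet ∞ b i)⟩
  refine ⟨⟨fun x => φ x * φ x, φ.contMDiff.mul φ.contMDiff⟩, s, by simp, ?_, fun t => ?_⟩
  · filter_upwards [φ.eventuallyEq_one] with x hx i
    change φ x • e.localFrame b i x = _
    rw [hx, Pi.one_apply, one_smul]
  · refine ⟨fun i => ⟨fun x => φ x * e.localFrameCoeff I b i x (t x), ?_⟩, ?_, fun i => ?_⟩
    · refine contMDiff_of_tsupport fun x hx => φ.contMDiffAt.mul ?_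
      exact contMDiffAt_localFrameCoeff b
        (hφ (closure_mono (Function.support_mul_subset_left _ _) hx))
        (t.contMDiff x) i
    · ext x
      refine Eq.trans ?_ (map_sum (evalSection I F V x) _ _).symm
      change (φ x * φ x) • t x =
        ∑ i, (φ x * e.localFrameCoeff I b i x (t x)) • φ x • e.localFrame b i x
      by_cases hx : x ∈ e.baseSet
      · conv_lhs => rw [e.eq_sum_localFrameCoeff_smul (I := I) (b := b) (s := t) hx]
        rw [Finset.smul_sum]
        refine Finset.sum_congr rfl fun i _ => ?_
        simp only [smul_smul]
        congr 1; ring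
      · simp [image_eq_zero_of_notMem_tsupport fun h => hx (hφ h)]
    · change φ x₀ * _ = _
      rw [φ.eq_one, one_mul]

/-- Every vector in a fibre is the value of a global section. -/
theorem evalSection_surjective (x : M) : Function.Surjective (evalSection I F V x) := by
  intro v
  let b := Module.finBasis ℝ F
  obtain ⟨-, s, -, hs, -⟩ := exists_global_frame (I := I) (V := V) b x
  have hx := FiberBundle.mem_baseSet_trivializationAt F V x
  refine ⟨∑ i, ((trivializationAt F V x).basisAt b hx).repr v i • s i, ?_⟩
  simp only [map_sum, map_smul]
  have hs' : ∀ i, evalSection I F V x (s i) =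
      (trivializationAt F V x).basisAt b hx i := by
    intro i; rw [← Trivialization.localFrame_apply_of_mem_baseSet]; exact hs.self_of_nhds i
  simp only [hs', Module.Basis.sum_repr]

/-- A `C^∞(M)`-linear functional on sections depends, at each point, only on the value of the
section at that point. -/
theorem eval_eq_of_apply_eq (Φ : Cₛ^∞⟮I; F, V⟯ →ₗ[C^∞⟮I, M; ℝ⟯] C^∞⟮I, M; ℝ⟯)
    {t t' : Cₛ^∞⟮I; F, V⟯} {x : M} (h : t x = t' x) : Φ t x = Φ t' x := by
  obtain ⟨ψ, s, hψ, -, hs⟩ := exists_global_frame (I := I) (V := V) (Module.finBasis ℝ F) x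
  have key (u : Cₛ^∞⟮I; F, V⟯) : Φ u x = ∑ i, (trivializationAt F V x).localFrameCoeff I
      (Module.finBasis ℝ F) i x (u x) * Φ (s i) x := by
    obtain ⟨c, hc, hcx⟩ := hs u
    have h₁ := congrArg (fun f : C^∞⟮I, M; ℝ⟯ => ContMDiffMap.evalRingHom x f) (congrArg Φ hc)
    simp only [map_smul, map_sum, smul_eq_mul, map_mul] at h₁
    change ψ x * Φ u x = ∑ i, c i x * Φ (s i) x at h₁
    simpa [hψ, hcx] using h₁
  rw [key, key, h]

variable (I F V) in
/-- A linear choice of global sections with prescribed value at a point. -/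
noncomputable def extendSection (x : M) : V x →ₗ[ℝ] Cₛ^∞⟮I; F, V⟯ :=
  ((evalSection I F V x).exists_rightInverse_of_surjective
    (LinearMap.range_eq_top.mpr (evalSection_surjective x))).choose

@[simp] theorem extendSection_apply_self (x : M) (v : V x) : extendSection I F V x v x = v :=
  LinearMap.congr_fun ((evalSection I F V x).exists_rightInverse_of_surjective
    (LinearMap.range_eq_top.mpr (evalSection_surjective x))).choose_spec v

/-- A family of linear maps between the fibres of two vector bundles is smooth if it maps smooth
sections to smooth sections. -/
theorem contMDiff_hom_of_apply {F' : Type*} [NormedAddCommGroup F'] [NormedSpace ℝ F']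
    {W : M → Type*} [TopologicalSpace (TotalSpace F' W)]
    [∀ x, AddCommGroup (W x)] [∀ x, Module ℝ (W x)] [∀ x, TopologicalSpace (W x)]
    [∀ x, IsTopologicalAddGroup (W x)] [∀ x, ContinuousSMul ℝ (W x)]
    [FiberBundle F' W] [VectorBundle ℝ F' W]
    (φ : ∀ x, V x →L[ℝ] W x)
    (h : ∀ s : Cₛ^∞⟮I; F, V⟯,
      ContMDiff I (I.prod 𝓘(ℝ, F')) ∞ fun x => TotalSpace.mk' F' x (φ x (s x))) :
    ContMDiff I (I.prod 𝓘(ℝ, F →L[ℝ] F')) ∞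
      fun x => TotalSpace.mk' (F →L[ℝ] F') (E := fun x => V x →L[ℝ] W x) x (φ x) := by
  intro x₀
  rw [contMDiffAt_hom_bundle]
  refine ⟨contMDiffAt_id, ?_⟩
  let b := Module.finBasis ℝ F
  obtain ⟨-, s, -, hs, -⟩ := exists_global_frame (I := I) (V := V) b x₀
  let b' (i) : F →L[ℝ] ℝ := LinearMap.toContinuousLinearMap (b.coord i)
  have hsm : ContMDiffAt I 𝓘(ℝ, F →L[ℝ] F') ∞ (fun x => ∑ i,
      ContinuousLinearMap.smulRightL ℝ F F' (b' i)
        (trivializationAt F' W x₀ ⟨x, φ x (s i x)⟩).2) x₀ := by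
    refine contMDiffAt_finsetSum fun i _ => ?_
    exact (ContinuousLinearMap.contMDiffAt _).comp x₀ ((contMDiffAt_section x₀).mp (h (s i) x₀))
  refine hsm.congr_of_eventuallyEq ?_
  filter_upwards [hs, (trivializationAt F V x₀).open_baseSet.mem_nhds
    (FiberBundle.mem_baseSet_trivializationAt F V x₀),
    (trivializationAt F' W x₀).open_baseSet.mem_nhds
    (FiberBundle.mem_baseSet_trivializationAt F' W x₀)] with x hx hxV hxW
  refine ContinuousLinearMap.coe_injective (b.ext fun j => ?_)
  simp [ContinuousLinearMap.inCoordinates, b', hx, hxV, Trivialization.basisAt,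
    Finsupp.single_apply, Trivialization.coe_linearMapAt_of_mem _ hxW,
    Trivialization.symmL_apply]
end Extension

section Cartan

variable {C X : Type*} [CommRing C] [LieRing X] [Module C X]

theorem Form.sub₁ (w : Form C X 1) (x y : X) : w ![x - y] = w ![x] - w ![y] := by
  rw [eq_sub_iff_add_eq, ← w.add₁, sub_add_cancel]

variable [LieRingModule X C] [LieRinehartRing C X]

theorem ι_d₁ (x : X) (w : Form C X 1) : ι x (d₁ w) = L₁ x w - d₀ (w ![x]) := by
  apply Form.ext₁; intro y
  simp only [ι_apply, d₁_apply, L₁_apply, d₀_apply, AlternatingMap.sub_apply]; ring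

theorem d₁_L₁ (x : X) (w : Form C X 1) : d₁ (L₁ x w) = L₂ x (d₁ w) := by
  apply Form.ext₂; intro y z
  have h : w ![⁅x, ⁅y, z⁆⁆] = w ![⁅⁅x, y⁆, z⁆] + w ![⁅y, ⁅x, z⁆⁆] := by
    rw [leibniz_lie, w.add₁]
  simp only [d₁_apply, L₁_apply, L₂_apply, lie_sub, h, lie_lie x y, lie_lie x z]
  ring

theorem d₁_d₀ (f : C) : d₁ (d₀ f : Form C X 1) = 0 := by
  apply Form.ext₂; intro x y
  simp [lie_lie]

theorem d₂_d₁ (w : Form C X 1) : d₂ (d₁ w) = 0 := by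
  apply Form.ext₃; intro x y z
  have h : w ![⁅x, ⁅y, z⁆⁆] = w ![⁅⁅x, y⁆, z⁆] - w ![⁅⁅x, z⁆, y⁆] := by
    rw [← w.sub₁, leibniz_lie, ← lie_skew y, sub_eq_add_neg]
  have h' : w ![⁅⁅y, z⁆, x⁆] = - w ![⁅x, ⁅y, z⁆⁆] := by
    rw [← lie_skew, ← neg_one_smul C, w.smul₁]; ring
  simp only [d₂_apply, d₁_apply, lie_sub, lie_lie x y (w ![z]), lie_lie x z (w ![y]),
    lie_lie y z (w ![x]), h', h, AlternatingMap.zero_apply]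
  ring

theorem d₁_sub (w w' : Form C X 1) : d₁ (w - w') = d₁ w - d₁ w' := by
  rw [eq_sub_iff_add_eq, ← d₁_add, sub_add_cancel]

theorem L₂_neg (x : X) (w : Form C X 2) : L₂ x (-w) = -L₂ x w := by
  rw [eq_neg_iff_add_eq_zero, ← L₂_add, neg_add_cancel]
  apply Form.ext₂; intro y z; simp

end Cartan

section Weil

variable {C X G : Type*} [CommRing C] [Algebra ℝ C] [LieRing X] [LieAlgebra ℝ X] [Module C X]
  [LieRingModule X C] [LieRinehartRing C X] [LieRinehartAlgebra ℝ C X]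
  [AddCommGroup G] [Module ℝ G] [Module C G] [IsScalarTower ℝ C G]

namespace Weil₁₂

theorem dVer_ofLinearMap (σ : G →ₗ[C] Form C X 1) : (ofLinearMap σ).dVer = 0 := by
  refine Weil₁₃.ext (LinearMap.ext fun α => ?_) (LinearMap.ext fun α => ?_)
  · change -d₂ (-d₁ (σ α)) = 0
    rw [← neg_one_smul ℝ (d₁ _), d₂_smulR, d₂_d₁, smul_zero, neg_zero]
  · exact neg_add_cancel _

theorem eq_ofLinearMap_of_dVer_eq_zero {c : Weil₁₂ C X G} (h : c.dVer = 0) :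
    c = ofLinearMap c.c₁ := by
  refine Weil₁₂.ext (LinearMap.ext fun α => ?_) rfl
  exact eq_neg_of_add_eq_zero_left (LinearMap.congr_fun (congrArg Weil₁₃.c₁ h) α)

/-- `(-dσ, σ)` is closed under the horizontal differential if and only if `σ` satisfies the two
equations of an IM form. -/
theorem dHor_ofLinearMap_eq_zero_iff (L : AlgebroidBracket C X G) (σ : G →ₗ[C] Form C X 1) :
    dHor L (ofLinearMap σ) = 0 ↔
      (∀ α β, σ α ![L.ρ β] = -σ β ![L.ρ α]) ∧
      ∀ α β, σ (L.bracket α β) =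
        L₁ (L.ρ α) (σ β) - L₁ (L.ρ β) (σ α) + d₀ (σ α ![L.ρ β]) := by
  have h₁ (α β : G) : (dHor L (ofLinearMap σ)).c₁ α β =
      L₁ (L.ρ α) (σ β) - L₁ (L.ρ β) (σ α) + d₀ (σ α ![L.ρ β]) - σ (L.bracket α β) := by
    change -σ (L.bracket α β) + L₁ (L.ρ α) (σ β) + ι (L.ρ β) (-d₁ (σ α)) = _
    rw [← zero_sub (d₁ _), ι_sub, ι_d₁, show ι (L.ρ β) (0 : Form C X 2) = 0 from rfl]
    abel
  refine ⟨fun h => ⟨fun α β => ?_, fun α β => ?_⟩, fun ⟨hs, hb⟩ => ?_⟩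
  · have h₂ : -σ β ![L.ρ α] - σ α ![L.ρ β] = 0 :=
      LinearMap.congr_fun₂ (congrArg Weil₂₂.c₂ h) α β
    exact (sub_eq_zero.mp h₂).symm
  · have h₂ : (dHor L (ofLinearMap σ)).c₁ α β = 0 := by rw [h]; rfl
    rw [h₁, sub_eq_zero] at h₂
    exact h₂.symm
  · refine Weil₂₂.ext (LinearMap.ext₂ fun α β => ?_)
      (LinearMap.ext fun α => LinearMap.ext fun β => ?_) (LinearMap.ext₂ fun α β => ?_)
    · change -(-d₁ (σ (L.bracket α β))) + L₂ (L.ρ α) (-d₁ (σ β)) - L₂ (L.ρ β) (-d₁ (σ α)) = 0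
      rw [hb, d₁_add, d₁_sub, d₁_d₀, d₁_L₁, d₁_L₁, L₂_neg, L₂_neg]
      abel
    · rw [h₁, hb, sub_self]; rfl
    · change -σ β ![L.ρ α] - σ α ![L.ρ β] = 0
      rw [hs α β, sub_self]

end Weil₁₂

end Weil

section Cotangent

variable {E : Type*} [NormedAddCommGroup E] [NormedSpace ℝ E] [FiniteDimensional ℝ E]
  {H : Type*} [TopologicalSpace H] {I : ModelWithCorners ℝ E H}
  {M : Type*} [TopologicalSpace M] [T2Space M] [ChartedSpace H M] [IsManifold I ∞ M]
  {F : Type*} [NormedAddCommGroup F] [NormedSpace ℝ F] [FiniteDimensional ℝ F]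
  {A : M → Type*} [TopologicalSpace (TotalSpace F A)]
  [∀ x, AddCommGroup (A x)] [∀ x, Module ℝ (A x)] [∀ x, TopologicalSpace (A x)]
  [FiberBundle F A] [VectorBundle ℝ F A] [ContMDiffVectorBundle ∞ F A I]

theorem CotangentMap.onSections_injective :
    Function.Injective (CotangentMap.onSections : CotangentMap I F A → _) := by
  intro σ τ h
  refine ContMDiffSection.ext fun x => ContinuousLinearMap.ext fun a => ?_
  refine ContinuousLinearMap.ext (M₁ := TangentSpace I x) (M₂ := ℝ) fun v => ?_
  obtain ⟨α, rfl⟩ := evalSection_surjective (I := I) (F := F) (V := A) x a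
  obtain ⟨V, rfl⟩ := evalSection_surjective (I := I) (F := E)
    (V := (TangentSpace I : M → Type _)) x v
  exact congrArg (fun w : DForm I M 1 => w ![V] x) (LinearMap.congr_fun h α)

variable [∀ x, IsTopologicalAddGroup (A x)] [∀ x, ContinuousSMul ℝ (A x)]

/-- A `C^∞(M)`-linear map from sections of `A` to `1`-forms comes from a bundle map. -/
theorem CotangentMap.onSections_surjective :
    Function.Surjective (CotangentMap.onSections : CotangentMap I F A → _) := by
  intro Φ
  let Φl (V : VF I M) : Cₛ^∞⟮I; F, A⟯ →ₗ[C^∞⟮I, M; ℝ⟯] C^∞⟮I, M; ℝ⟯ :=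
    { toFun := fun α => Φ α ![V]
      map_add' := fun α β => by rw [map_add]; rfl
      map_smul' := fun f α => by rw [map_smul]; rfl }
  let Φr (α : Cₛ^∞⟮I; F, A⟯) : VF I M →ₗ[C^∞⟮I, M; ℝ⟯] C^∞⟮I, M; ℝ⟯ :=
    { toFun := fun V => Φ α ![V]
      map_add' := fun V W => (Φ α).add₁ V W
      map_smul' := fun f V => (Φ α).smul₁ f V }
  have (x : M) : T2Space (A x) := FiberBundle.t2Space F A x
  have (x : M) : FiniteDimensional ℝ (A x) := VectorBundle.finiteDimensional ℝ F A x
  have (x : M) : T2Space (TangentSpace I x) := inferInstanceAs (T2Space E)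
  have (x : M) : FiniteDimensional ℝ (TangentSpace I x) :=
    inferInstanceAs (FiniteDimensional ℝ E)
  let B (x : M) : A x →ₗ[ℝ] TangentSpace I x →ₗ[ℝ] ℝ := LinearMap.mk₂ ℝ
    (fun a v => Φ (extendSection I F A x a) ![extendSection I E (TangentSpace I) x v] x)
    (fun a a' v => by rw [map_add, map_add]; rfl)
    (fun r a v => by rw [map_smul, LinearMap.map_smul_of_tower]; rfl)
    (fun a v v' => by rw [map_add, Form.add₁]; rfl)
    (fun r a v => by
      rw [map_smul]
      exact congrArg (fun f : C^∞⟮I, M; ℝ⟯ => f x)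
        ((Φr (extendSection I F A x a)).map_smul_of_tower r _))
  have hB (x : M) (α : Cₛ^∞⟮I; F, A⟯) (V : VF I M) :
      (B x).toContinuousBilinearMap (α x) (V x) = Φ α ![V] x := by
    rw [LinearMap.toContinuousBilinearMap_apply]
    refine Eq.trans (b := Φ (extendSection I F A x (α x)) ![V] x) ?_ ?_
    · exact eval_eq_of_apply_eq (Φr _) (extendSection_apply_self ..)
    · exact eval_eq_of_apply_eq (Φl V) (extendSection_apply_self ..)
  refine ⟨⟨fun x => (B x).toContinuousBilinearMap, ?_⟩, ?_⟩
  · refine contMDiff_hom_of_apply _ fun α => ?_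
    refine contMDiff_hom_of_apply (W := Bundle.Trivial M ℝ) _ fun V => ?_
    simp only [hB]
    intro x
    exact contMDiffAt_totalSpace.2 ⟨contMDiffAt_id, (Φ α ![V]).contMDiff x⟩
  · refine LinearMap.ext fun α => Form.ext₁ fun V => ?_
    ext x
    exact hB x α V

end Cotangent

end LieAlgd

theorem mainTheorem7
    {E : Type*} [NormedAddCommGroup E] [NormedSpace ℝ E] [FiniteDimensional ℝ E]
    {H : Type*} [TopologicalSpace H] (I : ModelWithCorners ℝ E H) [I.Boundaryless]
    {M : Type*} [TopologicalSpace M] [T2Space M] [SecondCountableTopology M]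
    [ChartedSpace H M] [IsManifold I ∞ M]
    (F : Type*) [NormedAddCommGroup F] [NormedSpace ℝ F] [FiniteDimensional ℝ F]
    (A : M → Type*) [TopologicalSpace (TotalSpace F A)]
    [∀ x, AddCommGroup (A x)] [∀ x, Module ℝ (A x)] [∀ x, TopologicalSpace (A x)]
    [∀ x, IsTopologicalAddGroup (A x)] [∀ x, ContinuousSMul ℝ (A x)]
    [FiberBundle F A] [VectorBundle ℝ F A] [ContMDiffVectorBundle ∞ F A I]
    (L : LieAlgd.LieAlgebroid I F A) :
    Set.BijOn (fun σ : LieAlgd.CotangentMap I F A => σ.toWeil)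
      {σ | L.IsIMForm σ}
      {c : LieAlgd.W₁₂ I F A | L.dHor c = 0 ∧ LieAlgd.dVer c = 0} := by
  have key (σ : LieAlgd.CotangentMap I F A) : L.dHor σ.toWeil = 0 ↔ L.IsIMForm σ :=
    LieAlgd.Weil₁₂.dHor_ofLinearMap_eq_zero_iff L.sections σ.onSections
  refine ⟨fun σ hσ => ⟨(key σ).mpr hσ, LieAlgd.Weil₁₂.dVer_ofLinearMap _⟩,
    fun σ _ τ _ h => ?_, fun c ⟨hh, hv⟩ => ?_⟩
  · exact LieAlgd.CotangentMap.onSections_injective (congrArg LieAlgd.Weil₁₂.c₁ h)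
  · obtain ⟨σ, hσ⟩ := LieAlgd.CotangentMap.onSections_surjective c.c₁
    have hc : σ.toWeil = c := by
      rw [LieAlgd.Weil₁₂.eq_ofLinearMap_of_dVer_eq_zero hv, ← hσ]; rfl
    subst hc
    exact ⟨σ, (key σ).mp hh, rfl⟩
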